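/- Let $n,N$ be natural numbers, let $dV$ be Lebesgue measure on $\mathbb{C}^n$ and $d\mu(z)=\pi^{-n}e^{-|z|^2}dV(z)$, where $z\cdot\overline{w}=\sum_k z_k\overline{w_k}$ and $|z|^2=z\cdot\overline z$. Let $K(w,z)=e^{w\cdot\overline z}$, $k(w,z)=K(w,z)/\sqrt{K(z,z)}$, and let $$\mathcal{B}[u](z)=\int_{\mathbb{C}^n}u(w)\,|k(w,z)|^2\,d\mu(w)$$ be the Berezin transform of $u\in L^2(\mathbb{C}^n,d\mu)$. Let $\mathrm{Sym}(\mathbb{C}^n)$ be the set of measurable functions $h:\mathbb{C}^n\to\mathbb{C}$ such that $h(z)e^{-c|z|^2}$ is essentially bounded for every $c>0$. For an entire function $h$ put $h^*(z)=\overline{h(\overline z)}$. For entire functions $f$ and $g$ with $g(z)=\sum_i a_iz^i$ (sum over multi-indices $i\in\mathbb{N}^n$), so that $g^*(z)=\sum_i\overline{a_i}z^i$, put $$g^*(\overline\zeta-\partial_\zeta)f(\zeta)=\sum_i\overline{a_i}\,(\overline{\zeta}-\partial_\zeta)^if(\zeta),\qquad (\overline{\zeta}-\partial_\zeta)^i=\prod_{k=1}^n(\overline{\zeta_k}-\partial_{\zeta_k})^{i_k},$$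 whenever the series converges absolutely, where $\partial_{\zeta_k}=\frac12(\partial_{x_k}-\mathrm{i}\,\partial_{y_k})$ for $\zeta_k=x_k+\mathrm{i}y_k$. Let $f_l,g_l\in\mathrm{Sym}(\mathbb{C}^n)$ be entire functions, $l=1,\dots,N$. Then for each $l$ the series defining $g_l^*(\overline\zeta-\partial_\zeta)f_l(\zeta)$ converges absolutely at every $\zeta\in\mathbb{C}^n$, and: (1) If $u\in L^2(\mathbb{C}^n,d\mu)$ satisfies $\mathcal{B}[u]=\sum_{l=1}^Nf_l\overline{g_l}$ on $\mathbb{C}^n$, then $$u(\zeta)=\sum_{l=1}^N g_l^*(\overline\zeta-\partial_\zeta)f_l(\zeta)\quad\text{for almost every }\zeta\in\mathbb{C}^n.$$ (2) Conversely, the function $\zeta\mapsto\sum_{l=1}^N g_l^*(\overline\zeta-\partial_\zeta)f_l(\zeta)$ belongs to $L^2(\mathbb{C}^n,d\mu)$ and its Berezin transform equals $\sum_{l=1}^Nf_l\overline{g_l}$ on $\mathbb{C}^n$. -/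

import Mathlib

open MeasureTheory
open scoped ComplexConjugate

namespace Fock

noncomputable section

/-- `z · w̄ = ∑ zᵢ w̄ᵢ` on `ℂⁿ`. -/
def herm {n : ℕ} (z w : Fin n → ℂ) : ℂ := ∑ i, z i * conj (w i)

/-- The square `|z|² = ∑ |zᵢ|²` of the Euclidean norm on `ℂⁿ`
(the norm that Mathlib puts on `Fin n → ℂ` is the sup norm, which is not used). -/
def absSq {n : ℕ} (z : Fin n → ℂ) : ℝ := ∑ i, ‖z i‖ ^ 2

/-- The Gaussian measure `dμ(z) = π⁻ⁿ exp (-|z|²) dV(z)`. -/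
def gaussian (n : ℕ) : Measure (Fin n → ℂ) :=
  volume.withDensity fun z => ENNReal.ofReal ((Real.pi ^ n)⁻¹ * Real.exp (-absSq z))

/-- The reproducing kernel `K(w, z) = exp (w · z̄)` of the Fock space. -/
def kernel {n : ℕ} (w z : Fin n → ℂ) : ℂ := Complex.exp (herm w z)

/-- The normalized kernel `k(w, z) = K(w, z) / √K(z, z)`; the number `K(z, z)` is positive real. -/
def normKernel {n : ℕ} (w z : Fin n → ℂ) : ℂ :=
  kernel w z / ((Real.sqrt (kernel z z).re : ℝ) : ℂ)

/-- The Berezin transform `B[u](z) = ⟨u k(·, z), k(·, z)⟩` in `L²(ℂⁿ, dμ)`. -/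
def berezin {n : ℕ} (u : (Fin n → ℂ) → ℂ) (z : Fin n → ℂ) : ℂ :=
  ∫ w, u w * normKernel w z * conj (normKernel w z) ∂(gaussian n)

/-- The space `D_c` of measurable `u` such that `u(z) exp (-c |z|²)` is essentially bounded. -/
def growthSpace (n : ℕ) (c : ℝ) : Set ((Fin n → ℂ) → ℂ) :=
  {u | Measurable u ∧ ∃ C : ℝ, ∀ᵐ z : Fin n → ℂ, ‖u z‖ * Real.exp (-(c * absSq z)) ≤ C}

/-- The symbol space `Sym(ℂⁿ) = ⋂_{c > 0} D_c`. -/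
def symSpace (n : ℕ) : Set ((Fin n → ℂ) → ℂ) := ⋂ (c : ℝ) (_ : 0 < c), growthSpace n c

/-- `H(ℂⁿ) ∩ Sym(ℂⁿ)`. -/
def entireSym (n : ℕ) : Set ((Fin n → ℂ) → ℂ) := {h | Differentiable ℂ h} ∩ symSpace n

/-- `h*(z)`, the conjugate of `h(z̄)`. -/
def conjStar {n : ℕ} (h : (Fin n → ℂ) → ℂ) (z : Fin n → ℂ) : ℂ := conj (h fun i => conj (z i))

/-- The Wirtinger derivative `∂ₖ = (∂/∂xₖ - i ∂/∂yₖ) / 2`. On holomorphic functions it is the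
complex partial derivative in the `k`-th variable; it is also defined on real differentiable
functions such as `ζ̄ₖ h(ζ)`. -/
def dz {n : ℕ} (k : Fin n) (h : (Fin n → ℂ) → ℂ) (z : Fin n → ℂ) : ℂ :=
  (fderiv ℝ h z (Pi.single k 1) - Complex.I * fderiv ℝ h z (Pi.single k Complex.I)) / 2

/-- The operator `ζ̄ₖ - ∂ₖ`. -/
def conjSubDz {n : ℕ} (k : Fin n) (h : (Fin n → ℂ) → ℂ) (z : Fin n → ℂ) : ℂ :=
  conj (z k) * h z - dz k h z

/-- The multi-index power `A^i = A₁^{i₁} ⋯ Aₙ^{iₙ}` of an `n`-tuple of operators on functions. -/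
def multiPow {n : ℕ} (A : Fin n → ((Fin n → ℂ) → ℂ) → ((Fin n → ℂ) → ℂ)) (i : Fin n → ℕ)
    (h : (Fin n → ℂ) → ℂ) : (Fin n → ℂ) → ℂ :=
  (List.finRange n).foldr (fun k v => (A k)^[i k] v) h

/-- The Taylor coefficient `∂^i h(0) / i!` at the origin. -/
def taylorCoeff {n : ℕ} (h : (Fin n → ℂ) → ℂ) (i : Fin n → ℕ) : ℂ :=
  multiPow dz i h 0 / ((∏ k, (i k).factorial : ℕ) : ℂ)

/-- The term of multi-index `i` in the series defining `G(ζ̄ - ∂_ζ) f(ζ)`. -/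
def opTerm {n : ℕ} (G f : (Fin n → ℂ) → ℂ) (ζ : Fin n → ℂ) (i : Fin n → ℕ) : ℂ :=
  taylorCoeff G i * multiPow conjSubDz i f ζ

/-- `G(ζ̄ - ∂_ζ) f(ζ) = ∑_i b_i (ζ̄ - ∂_ζ)^i f(ζ)` where `G(z) = ∑_i b_i z^i` is the Taylor
series of `G` at the origin. -/
def opApply {n : ℕ} (G f : (Fin n → ℂ) → ℂ) (ζ : Fin n → ℂ) : ℂ := ∑' i, opTerm G f ζ i

end

end Fock

namespace Fock

section Elementary

variable {n : ℕ}

lemma absSq_nonneg (z : Fin n → ℂ) : 0 ≤ absSq z := Finset.sum_nonneg fun _ _ => sq_nonneg _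

@[fun_prop]
lemma continuous_absSq : Continuous (absSq : (Fin n → ℂ) → ℝ) := by
  unfold absSq; fun_prop

@[fun_prop]
lemma continuous_herm {X : Type*} [TopologicalSpace X] {a b : X → Fin n → ℂ}
    (ha : Continuous a) (hb : Continuous b) : Continuous fun x => herm (a x) (b x) := by
  unfold herm; fun_prop

lemma absSq_neg (z : Fin n → ℂ) : absSq (-z) = absSq z := by simp [absSq]

lemma herm_add_left (a b c : Fin n → ℂ) : herm (a + b) c = herm a c + herm b c := by
  simp [herm, add_mul, Finset.sum_add_distrib]

lemma herm_add_right (a b c : Fin n → ℂ) : herm a (b + c) = herm a b + herm a c := by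
  simp [herm, mul_add, Finset.sum_add_distrib]

lemma herm_neg_left (a b : Fin n → ℂ) : herm (-a) b = -herm a b := by
  simp [herm]

lemma herm_zero_left (b : Fin n → ℂ) : herm 0 b = 0 := by
  simp [herm]

lemma conj_herm (a b : Fin n → ℂ) : conj (herm a b) = herm b a := by
  simp [herm, mul_comm]

lemma herm_self (z : Fin n → ℂ) : herm z z = (absSq z : ℂ) := by
  simp [herm, absSq, Complex.mul_conj, Complex.normSq_eq_norm_sq]

lemma absSq_add_le {ε : ℝ} (hε : 0 < ε) (a b : Fin n → ℂ) :
    absSq (a + b) ≤ (1 + ε) * absSq a + (1 + ε⁻¹) * absSq b := by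
  unfold absSq
  rw [Finset.mul_sum, Finset.mul_sum, ← Finset.sum_add_distrib]
  refine Finset.sum_le_sum fun k _ => ?_
  have h1 : ‖(a + b) k‖ ^ 2 ≤ (‖a k‖ + ‖b k‖) ^ 2 := by
    gcongr; exact norm_add_le _ _
  have h2 : 0 ≤ ε⁻¹ * (ε * ‖a k‖ - ‖b k‖) ^ 2 := by positivity
  have h3 : ε⁻¹ * (ε * ‖a k‖ - ‖b k‖) ^ 2
      = ε * ‖a k‖ ^ 2 - 2 * ‖a k‖ * ‖b k‖ + ε⁻¹ * ‖b k‖ ^ 2 := by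
    field_simp; ring
  nlinarith

lemma sum_norm_mul_norm_le {ε : ℝ} (hε : 0 < ε) (a b : Fin n → ℂ) :
    ∑ k, ‖a k‖ * ‖b k‖ ≤ ε * absSq a + (4 * ε)⁻¹ * absSq b := by
  unfold absSq
  rw [Finset.mul_sum, Finset.mul_sum, ← Finset.sum_add_distrib]
  refine Finset.sum_le_sum fun k _ => ?_
  have h2 : 0 ≤ (4 * ε)⁻¹ * (2 * ε * ‖a k‖ - ‖b k‖) ^ 2 := by positivity
  have h3 : (4 * ε)⁻¹ * (2 * ε * ‖a k‖ - ‖b k‖) ^ 2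
      = ε * ‖a k‖ ^ 2 - ‖a k‖ * ‖b k‖ + (4 * ε)⁻¹ * ‖b k‖ ^ 2 := by
    field_simp; ring
  linarith

lemma norm_herm_le_sum (a b : Fin n → ℂ) : ‖herm a b‖ ≤ ∑ k, ‖a k‖ * ‖b k‖ := by
  refine (norm_sum_le _ _).trans (Finset.sum_le_sum fun k _ => ?_)
  simp

lemma norm_herm_le {ε : ℝ} (hε : 0 < ε) (a b : Fin n → ℂ) :
    ‖herm a b‖ ≤ ε * absSq a + (4 * ε)⁻¹ * absSq b :=
  (norm_herm_le_sum a b).trans (sum_norm_mul_norm_le hε a b)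

lemma sum_norm_le {ε : ℝ} (hε : 0 < ε) (a : Fin n → ℂ) :
    ∑ k, ‖a k‖ ≤ ε * absSq a + (4 * ε)⁻¹ * n := by
  simpa [absSq] using sum_norm_mul_norm_le hε a (fun _ => 1)

end Elementary

section Gaussian

variable {n : ℕ}

lemma exp_neg_mul_absSq (a : ℝ) (z : Fin n → ℂ) :
    Real.exp (-a * absSq z) = ∏ k, Real.exp (-a * ‖z k‖ ^ 2) := by
  rw [absSq, Finset.mul_sum, Real.exp_sum]

lemma integrable_exp_neg_mul_sq_norm {a : ℝ} (ha : 0 < a) :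
    Integrable fun z : ℂ => Real.exp (-a * ‖z‖ ^ 2) := by
  have := (GaussianFourier.integrable_cexp_neg_mul_sq_norm_add (V := ℂ) (b := (a : ℂ))
    (by simpa) 0 0).norm
  simpa [Complex.norm_exp, ← Complex.ofReal_pow] using this

lemma integral_exp_neg_sq_norm : ∫ z : ℂ, Real.exp (-1 * ‖z‖ ^ 2) = Real.pi := by
  have := GaussianFourier.integral_rexp_neg_mul_sq_norm (V := ℂ) (b := 1) one_pos
  simpa using this

lemma integrable_exp_neg_mul_absSq {a : ℝ} (ha : 0 < a) :
    Integrable fun z : Fin n → ℂ => Real.exp (-a * absSq z) := by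
  simp_rw [exp_neg_mul_absSq]
  exact Integrable.fintype_prod fun _ => integrable_exp_neg_mul_sq_norm ha

lemma measurable_gaussian_density :
    Measurable fun z : Fin n → ℂ =>
      ENNReal.ofReal ((Real.pi ^ n)⁻¹ * Real.exp (-absSq z)) := by
  fun_prop

lemma integral_gaussian_eq (F : (Fin n → ℂ) → ℂ) :
    ∫ w, F w ∂(gaussian n) = ∫ w, ((Real.pi ^ n)⁻¹ * Real.exp (-absSq w)) • F w := by
  rw [gaussian, integral_withDensity_eq_integral_toReal_smul measurable_gaussian_density
    (by simp)]
  congr with w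
  rw [ENNReal.toReal_ofReal (by positivity)]

instance isProbabilityMeasure_gaussian : IsProbabilityMeasure (gaussian n) := by
  constructor
  rw [gaussian, withDensity_apply _ MeasurableSet.univ, Measure.restrict_univ,
    ← ofReal_integral_eq_lintegral_ofReal _ (Filter.Eventually.of_forall fun z => by positivity)]
  · rw [integral_const_mul]
    have : ∀ z : Fin n → ℂ, Real.exp (-absSq z) = ∏ k, Real.exp (-1 * ‖z k‖ ^ 2) := fun z => by
      rw [← exp_neg_mul_absSq]; simp
    simp_rw [this]
    rw [integral_fintype_prod_volume_eq_prod (fun (_ : Fin n) (x : ℂ) => Real.exp (-1 * ‖x‖ ^ 2))]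
    simp_rw [integral_exp_neg_sq_norm]
    simp [Real.pi_ne_zero]
  · refine Integrable.const_mul ?_ _
    simpa using integrable_exp_neg_mul_absSq (n := n) one_pos

lemma integrable_exp_mul_absSq {c : ℝ} (hc : c < 1) :
    Integrable (fun w : Fin n → ℂ => Real.exp (c * absSq w)) (gaussian n) := by
  rw [gaussian, integrable_withDensity_iff_integrable_smul' measurable_gaussian_density (by simp)]
  refine ((integrable_exp_neg_mul_absSq (n := n) (sub_pos.2 hc)).const_mul
    (Real.pi ^ n)⁻¹).congr (Filter.Eventually.of_forall fun w => ?_)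
  simp only [smul_eq_mul]
  rw [ENNReal.toReal_ofReal (by positivity), mul_assoc, ← Real.exp_add]
  congr 3; ring

lemma integrable_of_growth {E : Type*} [NormedAddCommGroup E] {φ : (Fin n → ℂ) → E}
    (hφ : AEStronglyMeasurable φ (gaussian n))
    {C c : ℝ} (hc : c < 1) (h : ∀ w, ‖φ w‖ ≤ C * Real.exp (c * absSq w)) :
    Integrable φ (gaussian n) :=
  ((integrable_exp_mul_absSq hc).const_mul C).mono' hφ (Filter.Eventually.of_forall h)

/-- The Gaussian measure under translation. -/
lemma integral_gaussian_translate (F : (Fin n → ℂ) → ℂ) (z : Fin n → ℂ) :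
    ∫ w, F w ∂(gaussian n)
      = ∫ v, F (z + v) * Complex.exp (-herm v z - herm z v - herm z z) ∂(gaussian n) := by
  rw [integral_gaussian_eq, integral_gaussian_eq, ← integral_add_left_eq_self _ z]
  congr with v
  simp only [Complex.real_smul, Complex.ofReal_mul, Complex.ofReal_exp, Complex.ofReal_neg,
    ← herm_self]
  have : Complex.exp (-herm (z + v) (z + v))
      = Complex.exp (-herm v v) * Complex.exp (-herm v z - herm z v - herm z z) := by
    rw [← Complex.exp_add]
    congr 1
    simp only [herm_add_left, herm_add_right]; ring
  rw [this]; ring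

lemma normKernel_mul_conj (w z : Fin n → ℂ) :
    normKernel w z * conj (normKernel w z)
      = Complex.exp (herm w z + herm z w) * Complex.exp (-herm z z) := by
  have h0 : (kernel z z).re = Real.exp (absSq z) := by
    rw [kernel, herm_self, ← Complex.ofReal_exp, Complex.ofReal_re]
  have h1 : (((Real.sqrt (Real.exp (absSq z)) : ℝ)) : ℂ) * (Real.sqrt (Real.exp (absSq z)) : ℝ)
      = Complex.exp (herm z z) := by
    rw [← Complex.ofReal_mul, Real.mul_self_sqrt (Real.exp_pos _).le, herm_self,
      Complex.ofReal_exp]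
  rw [normKernel, h0, map_div₀, Complex.conj_ofReal, div_mul_div_comm, h1, kernel,
    ← Complex.exp_conj, conj_herm, ← Complex.exp_add, ← Complex.exp_sub, ← Complex.exp_add,
    sub_eq_add_neg]

lemma berezin_eq_integral_translate (u : (Fin n → ℂ) → ℂ) (z : Fin n → ℂ) :
    berezin u z = ∫ v, u (z + v) ∂(gaussian n) := by
  rw [berezin, integral_gaussian_translate _ z]
  congr with v
  have h : herm (z + v) z + herm z (z + v) + -herm z z
      + (-herm v z - herm z v - herm z z) = 0 := by
    simp only [herm_add_left, herm_add_right]; ring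
  rw [mul_assoc (u _), normKernel_mul_conj, mul_assoc, ← Complex.exp_add, ← Complex.exp_add, h,
    Complex.exp_zero, mul_one]

lemma measurePreserving_smul_gaussian {c : ℂ} (hc : ‖c‖ = 1) :
    MeasurePreserving (fun w : Fin n → ℂ => c • w) (gaussian n) (gaussian n) := by
  have hvol : MeasurePreserving (fun w : Fin n → ℂ => c • w) := by
    have h1 : MeasurePreserving (fun w : ℂ => c * w) := by
      exact (rotation (⟨c, by simpa [Submonoid.unitSphere] using hc⟩ : Circle)).measurePreserving
    exact volume_preserving_pi fun _ => h1
  refine ⟨hvol.measurable, ?_⟩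
  ext s hs
  rw [Measure.map_apply hvol.measurable hs, gaussian, withDensity_apply _ hs,
    withDensity_apply _ (hvol.measurable hs),
    ← hvol.setLIntegral_comp_preimage hs measurable_gaussian_density]
  congr with w
  simp [absSq, hc]

/-- The mean value property of entire functions with respect to the Gaussian measure. -/
lemma integral_gaussian_entire {F : (Fin n → ℂ) → ℂ} (hF : Differentiable ℂ F)
    {C c : ℝ} (hc : c < 1) (h : ∀ w, ‖F w‖ ≤ C * Real.exp (c * absSq w)) :
    ∫ w, F w ∂(gaussian n) = F 0 := by
  have hFi : Integrable F (gaussian n) :=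
    integrable_of_growth hF.continuous.aestronglyMeasurable hc h
  have hrot : ∀ θ : ℝ, ∫ w, F (circleMap 0 1 θ • w) ∂(gaussian n) = ∫ w, F w ∂(gaussian n) := by
    intro θ
    have hmp := measurePreserving_smul_gaussian (n := n) (c := circleMap 0 1 θ) (by simp)
    have := integral_map (μ := gaussian n) hmp.measurable.aemeasurable
      (f := F) hF.continuous.aestronglyMeasurable
    rw [← this, hmp.map_eq]
  have hmean : ∀ w, ∫ θ in (0 : ℝ)..2 * Real.pi, F (circleMap 0 1 θ • w)
      = (2 * Real.pi) • F 0 := by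
    intro w
    have h1 : Differentiable ℂ fun t : ℂ => F (t • w) := by fun_prop
    have h2 := (h1.diffContOnCl (s := Metric.ball 0 |1|)).circleAverage
    rw [Real.circleAverage_def] at h2
    simp only [zero_smul] at h2
    rw [← h2, smul_inv_smul₀ (by positivity)]
  have hint : Integrable (Function.uncurry fun (θ : ℝ) (w : Fin n → ℂ) => F (circleMap 0 1 θ • w))
      ((volume.restrict (Set.uIoc 0 (2 * Real.pi))).prod (gaussian n)) := by
    have : IsFiniteMeasure ((volume : Measure ℝ).restrict (Set.uIoc 0 (2 * Real.pi))) := by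
      rw [Set.uIoc]; infer_instance
    have hbd := ((integrable_const (1 : ℝ)
      (μ := volume.restrict (Set.uIoc 0 (2 * Real.pi)))).mul_prod
        ((integrable_exp_mul_absSq (n := n) hc).const_mul C))
    refine hbd.mono' (Continuous.aestronglyMeasurable ?_) (Filter.Eventually.of_forall fun p => ?_)
    · have := hF.continuous
      simp only [Function.uncurry_def]
      fun_prop
    · simp only [Function.uncurry_def, one_mul]
      refine (h _).trans_eq ?_
      congr 3
      simp [absSq]
  have hswap := intervalIntegral_integral_swap hint
  simp_rw [hrot, hmean] at hswap
  simp only [intervalIntegral.integral_const, sub_zero, integral_const, probReal_univ,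
    one_smul] at hswap
  exact smul_right_injective ℂ (by positivity : (2 * Real.pi) ≠ 0) hswap

/-- The reproducing formula. -/
lemma integral_mul_exp_herm {f : (Fin n → ℂ) → ℂ} (hf : Differentiable ℂ f)
    {C c : ℝ} (hc0 : 0 ≤ c) (hc : c < 1) (h : ∀ w, ‖f w‖ ≤ C * Real.exp (c * absSq w))
    (z : Fin n → ℂ) :
    ∫ w, f w * Complex.exp (herm z w) ∂(gaussian n) = f z := by
  have hC : 0 ≤ C := by
    have := (norm_nonneg _).trans (h 0)
    exact nonneg_of_mul_nonneg_left this (Real.exp_pos _)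
  rw [integral_gaussian_translate _ z]
  have hd : Differentiable ℂ fun v : Fin n → ℂ => f (z + v) * Complex.exp (-herm v z) := by
    unfold herm; fun_prop
  set δ := (1 - c) / 3 with hδ
  have hδ0 : 0 < δ := by rw [hδ]; linarith
  have hb : ∀ v : Fin n → ℂ, ‖f (z + v) * Complex.exp (-herm v z)‖
      ≤ (C * Real.exp (c * (1 + δ⁻¹) * absSq z + (4 * δ)⁻¹ * absSq z))
        * Real.exp ((c * (1 + δ) + δ) * absSq v) := by
    intro v
    rw [norm_mul]
    have h1 : ‖Complex.exp (-herm v z)‖ ≤ Real.exp (δ * absSq v + (4 * δ)⁻¹ * absSq z) := by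
      refine (Complex.norm_exp_le_exp_norm _).trans (Real.exp_le_exp.2 ?_)
      rw [norm_neg]; exact norm_herm_le hδ0 _ _
    have h2 : ‖f (z + v)‖ ≤ C * Real.exp (c * ((1 + δ) * absSq v + (1 + δ⁻¹) * absSq z)) := by
      refine (h _).trans ?_
      gcongr
      rw [add_comm z v]; exact absSq_add_le hδ0 _ _
    refine (mul_le_mul h2 h1 (norm_nonneg _) (by positivity)).trans_eq ?_
    rw [mul_assoc, mul_assoc, ← Real.exp_add, ← Real.exp_add]
    congr 2; ring
  have hlt : c * (1 + δ) + δ < 1 := by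
    have : c * δ ≤ δ := by nlinarith
    have : 3 * δ = 1 - c := by rw [hδ]; ring
    nlinarith
  have := integral_gaussian_entire hd hlt hb
  simp only [add_zero, herm_zero_left, neg_zero, Complex.exp_zero, mul_one] at this
  rw [← this]
  congr with v
  rw [mul_assoc, ← Complex.exp_add]
  congr 2
  simp only [herm_add_right]; ring

end Gaussian

section Wirtinger

variable {n : ℕ}

lemma dz_of_hasFDerivAt {h : (Fin n → ℂ) → ℂ} {D : (Fin n → ℂ) →L[ℂ] ℂ} {z : Fin n → ℂ}
    (hD : HasFDerivAt h D z) (k : Fin n) : dz k h z = D (Pi.single k 1) := by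
  have h1 : (Pi.single k Complex.I : Fin n → ℂ) = Complex.I • Pi.single k 1 := by
    rw [← Pi.single_smul]; simp
  rw [dz, (hD.restrictScalars ℝ).fderiv]
  simp only [ContinuousLinearMap.coe_restrictScalars', h1, map_smul, smul_eq_mul]
  rw [← mul_assoc, Complex.I_mul_I]; ring

lemma dz_sub {h₁ h₂ : (Fin n → ℂ) → ℂ} {z : Fin n → ℂ} (hd₁ : DifferentiableAt ℝ h₁ z)
    (hd₂ : DifferentiableAt ℝ h₂ z) (k : Fin n) :
    dz k (fun ζ => h₁ ζ - h₂ ζ) z = dz k h₁ z - dz k h₂ z := by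
  simp only [dz, fderiv_fun_sub hd₁ hd₂, sub_apply]
  ring

lemma dz_conj_mul {h : (Fin n → ℂ) → ℂ} {z : Fin n → ℂ} (hd : DifferentiableAt ℝ h z)
    (j k : Fin n) : dz k (fun ζ => conj (ζ j) * h ζ) z = conj (z j) * dz k h z := by
  have h1 : HasFDerivAt (fun ζ : Fin n → ℂ => conj (ζ j))
      (Complex.conjCLE.toContinuousLinearMap.comp
        (ContinuousLinearMap.proj (R := ℝ) (φ := fun _ : Fin n => ℂ) j)) z :=
    (Complex.conjCLE.toContinuousLinearMap.comp
        (ContinuousLinearMap.proj (R := ℝ) (φ := fun _ : Fin n => ℂ) j)).hasFDerivAt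
  rw [dz, (h1.fun_mul hd.hasFDerivAt).fderiv, dz]
  rcases eq_or_ne j k with rfl | hjk
  · simp
    linear_combination (h z / 2) * Complex.I_mul_I
  · simp [hjk]
    ring

lemma differentiableAt_conj_mul {h : (Fin n → ℂ) → ℂ} {z : Fin n → ℂ}
    (hd : DifferentiableAt ℝ h z) (j : Fin n) :
    DifferentiableAt ℝ (fun ζ => conj (ζ j) * h ζ) z := by
  refine DifferentiableAt.mul ?_ hd
  exact (Complex.conjCLE.toContinuousLinearMap.comp
    (ContinuousLinearMap.proj (R := ℝ) (φ := fun _ : Fin n => ℂ) j)).differentiableAt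

end Wirtinger

section ExpIntegral

variable {n : ℕ} {α : Type*} [MeasurableSpace α] {ν : Measure α} {a : α → Fin n → ℂ}
  {φ : α → ℂ}

/-- `φ` has exponential moments of all orders with respect to `a`. -/
structure ExpMoments (ν : Measure α) (a : α → Fin n → ℂ) (φ : α → ℂ) : Prop where
  aesm : AEStronglyMeasurable φ ν
  meas : Measurable a
  int : ∀ R : ℝ, Integrable (fun w => ‖φ w‖ * Real.exp (R * ∑ k, ‖a w k‖)) ν

lemma ExpMoments.mul (h : ExpMoments ν a φ) (k : Fin n) :
    ExpMoments ν a (fun w => φ w * a w k) := by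
  have hm := h.meas
  refine ⟨h.aesm.mul (by fun_prop), hm, fun R => ?_⟩
  refine (h.int (R + 1)).mono' ?_ (Filter.Eventually.of_forall fun w => ?_)
  · exact (h.aesm.mul (by fun_prop)).norm.mul (by fun_prop)
  · rw [Real.norm_of_nonneg (by positivity), norm_mul, mul_assoc]
    gcongr
    rw [add_mul, one_mul, Real.exp_add, mul_comm]
    gcongr
    refine le_trans ?_ (Real.add_one_le_exp _)
    have := Finset.single_le_sum (f := fun k => ‖a w k‖) (fun i _ => norm_nonneg _)
      (Finset.mem_univ k)
    linarith

lemma ExpMoments.sub {ψ : α → ℂ} (h : ExpMoments ν a φ) (h' : ExpMoments ν a ψ) :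
    ExpMoments ν a (fun w => φ w - ψ w) := by
  have hm := h.meas
  refine ⟨h.aesm.sub h'.aesm, hm, fun R => ?_⟩
  refine ((h.int R).add (h'.int R)).mono' ?_ (Filter.Eventually.of_forall fun w => ?_)
  · exact (h.aesm.sub h'.aesm).norm.mul (by fun_prop)
  · rw [Real.norm_of_nonneg (by positivity), Pi.add_apply, ← add_mul]
    gcongr
    exact norm_sub_le _ _

lemma ExpMoments.const_mul (h : ExpMoments ν a φ) (c : ℂ) :
    ExpMoments ν a (fun w => c * φ w) := by
  refine ⟨h.aesm.const_mul c, h.meas, fun R => ?_⟩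
  refine ((h.int R).const_mul ‖c‖).congr (Filter.Eventually.of_forall fun w => ?_)
  simp only [norm_mul]; ring

lemma norm_exp_sum_mul_le {z b : Fin n → ℂ} {R : ℝ} (hR : ‖z‖ ≤ R) :
    ‖Complex.exp (∑ k, z k * b k)‖ ≤ Real.exp (R * ∑ k, ‖b k‖) := by
  refine (Complex.norm_exp_le_exp_norm _).trans (Real.exp_le_exp.2 ?_)
  rw [Finset.mul_sum]
  refine (norm_sum_le _ _).trans (Finset.sum_le_sum fun k _ => ?_)
  rw [norm_mul]
  gcongr
  exact (norm_le_pi_norm z k).trans hR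

lemma ExpMoments.aesm_mul_exp (h : ExpMoments ν a φ) (z : Fin n → ℂ) :
    AEStronglyMeasurable (fun w => φ w * Complex.exp (∑ k, z k * a w k)) ν := by
  have hm := h.meas
  exact h.aesm.mul (by fun_prop)

lemma ExpMoments.integrable (h : ExpMoments ν a φ) (z : Fin n → ℂ) :
    Integrable (fun w => φ w * Complex.exp (∑ k, z k * a w k)) ν := by
  refine (h.int ‖z‖).mono' (h.aesm_mul_exp z) (Filter.Eventually.of_forall fun w => ?_)
  rw [norm_mul]
  gcongr
  exact norm_exp_sum_mul_le le_rfl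

/-- The linear form `z ↦ ∑ zₖ bₖ`. -/
noncomputable def linForm (b : Fin n → ℂ) : (Fin n → ℂ) →L[ℂ] ℂ :=
  ∑ k, b k • ContinuousLinearMap.proj (R := ℂ) (φ := fun _ : Fin n => ℂ) k

lemma linForm_apply (b z : Fin n → ℂ) : linForm b z = ∑ k, z k * b k := by
  simp [linForm, mul_comm]

lemma norm_linForm_le (b : Fin n → ℂ) : ‖linForm b‖ ≤ ∑ k, ‖b k‖ := by
  refine ContinuousLinearMap.opNorm_le_bound _ (by positivity) fun z => ?_
  rw [linForm_apply, Finset.sum_mul]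
  refine (norm_sum_le _ _).trans (Finset.sum_le_sum fun k _ => ?_)
  rw [norm_mul, mul_comm]
  gcongr
  exact norm_le_pi_norm z k

lemma measurable_linForm : Measurable (linForm : (Fin n → ℂ) → _) := by
  refine Continuous.measurable ?_
  unfold linForm
  fun_prop

lemma norm_mul_exp_smul_linForm_le {x : ℂ} {z b : Fin n → ℂ} {R : ℝ} (hR : ‖z‖ ≤ R) :
    ‖(x * Complex.exp (∑ k, z k * b k)) • linForm b‖
      ≤ ‖x‖ * Real.exp ((R + 1) * ∑ k, ‖b k‖) := by
  rw [norm_smul, norm_mul, mul_assoc]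
  gcongr
  have h1 := norm_exp_sum_mul_le (b := b) hR
  have h2 : ‖linForm b‖ ≤ Real.exp (∑ k, ‖b k‖) :=
    (norm_linForm_le _).trans (by linarith [Real.add_one_le_exp (∑ k, ‖b k‖)])
  refine (mul_le_mul h1 h2 (norm_nonneg _) (Real.exp_pos _).le).trans_eq ?_
  rw [← Real.exp_add]; congr 1; ring

lemma ExpMoments.aesm_smul_linForm (h : ExpMoments ν a φ) (z : Fin n → ℂ) :
    AEStronglyMeasurable
      (fun w => (φ w * Complex.exp (∑ k, z k * a w k)) • linForm (a w)) ν :=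
  (h.aesm_mul_exp z).smul (measurable_linForm.comp h.meas).aestronglyMeasurable

lemma hasFDerivAt_mul_exp (x : ℂ) (b z : Fin n → ℂ) :
    HasFDerivAt (fun ζ : Fin n → ℂ => x * Complex.exp (∑ k, ζ k * b k))
      ((x * Complex.exp (∑ k, z k * b k)) • linForm b) z := by
  have h2 := (linForm b).hasFDerivAt (x := z).cexp.const_mul x
  rw [smul_smul] at h2
  simpa only [linForm_apply] using h2

lemma ExpMoments.hasFDerivAt (h : ExpMoments ν a φ) (z : Fin n → ℂ) :
    HasFDerivAt (fun ζ => ∫ w, φ w * Complex.exp (∑ k, ζ k * a w k) ∂ν)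
      (∫ w, (φ w * Complex.exp (∑ k, z k * a w k)) • linForm (a w) ∂ν) z := by
  refine hasFDerivAt_integral_of_dominated_of_fderiv_le (𝕜 := ℂ)
    (μ := ν) (x₀ := z) (s := Metric.ball z 1)
    (F := fun ζ w => φ w * Complex.exp (∑ k, ζ k * a w k))
    (F' := fun ζ w => (φ w * Complex.exp (∑ k, ζ k * a w k)) • linForm (a w))
    (bound := fun w => ‖φ w‖ * Real.exp ((‖z‖ + 1 + 1) * ∑ k, ‖a w k‖))
    (Metric.ball_mem_nhds z one_pos) (Filter.Eventually.of_forall h.aesm_mul_exp)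
    (h.integrable z) (h.aesm_smul_linForm z)
    (Filter.Eventually.of_forall fun w ζ hζ => norm_mul_exp_smul_linForm_le ?_) (h.int _)
    (Filter.Eventually.of_forall fun w ζ _ => hasFDerivAt_mul_exp (φ w) (a w) ζ)
  have := norm_le_norm_add_norm_sub' ζ z
  rw [Metric.mem_ball, dist_eq_norm] at hζ
  linarith

lemma ExpMoments.dz_eq (h : ExpMoments ν a φ) (k : Fin n) (z : Fin n → ℂ) :
    dz k (fun ζ => ∫ w, φ w * Complex.exp (∑ j, ζ j * a w j) ∂ν) z
      = ∫ w, φ w * a w k * Complex.exp (∑ j, z j * a w j) ∂ν := by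
  rw [dz_of_hasFDerivAt (h.hasFDerivAt z), ContinuousLinearMap.integral_apply]
  · congr with w
    simp [linForm_apply, Pi.single_apply]
    ring
  · exact (h.int (‖z‖ + 1)).mono' (h.aesm_smul_linForm z)
      (Filter.Eventually.of_forall fun w => norm_mul_exp_smul_linForm_le le_rfl)

lemma ExpMoments.mul_pow (h : ExpMoments ν a φ) (k : Fin n) (m : ℕ) :
    ExpMoments ν a (fun w => φ w * a w k ^ m) := by
  induction m with
  | zero => simpa using h
  | succ m ih => simpa [pow_succ, mul_assoc] using ih.mul k

lemma ExpMoments.dz_iterate (h : ExpMoments ν a φ) (k : Fin n) (m : ℕ) :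
    (dz k)^[m] (fun ζ => ∫ w, φ w * Complex.exp (∑ j, ζ j * a w j) ∂ν)
      = fun ζ => ∫ w, φ w * a w k ^ m * Complex.exp (∑ j, ζ j * a w j) ∂ν := by
  induction m with
  | zero => simp
  | succ m ih =>
    rw [Function.iterate_succ_apply', ih]
    ext ζ
    rw [(h.mul_pow k m).dz_eq]
    simp [pow_succ, mul_assoc]

lemma ExpMoments.foldr_dz (h : ExpMoments ν a φ) (i : Fin n → ℕ) (l : List (Fin n)) :
    ExpMoments ν a (fun w => φ w * (l.map fun k => a w k ^ i k).prod) ∧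
    l.foldr (fun k v => (dz k)^[i k] v) (fun ζ => ∫ w, φ w * Complex.exp (∑ j, ζ j * a w j) ∂ν)
      = fun ζ => ∫ w, φ w * (l.map fun k => a w k ^ i k).prod
          * Complex.exp (∑ j, ζ j * a w j) ∂ν := by
  induction l with
  | nil => simpa using h
  | cons k l ih =>
    have hassoc : ∀ w, φ w * (a w k ^ i k * (l.map fun k => a w k ^ i k).prod)
        = φ w * (l.map fun k => a w k ^ i k).prod * a w k ^ i k := fun w => by ring
    simp only [List.foldr_cons, ih.2, List.map_cons, List.prod_cons, hassoc]
    exact ⟨ih.1.mul_pow k _, ih.1.dz_iterate k _⟩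

lemma ExpMoments.multiPow_dz (h : ExpMoments ν a φ) (i : Fin n → ℕ) (z : Fin n → ℂ) :
    multiPow dz i (fun ζ => ∫ w, φ w * Complex.exp (∑ j, ζ j * a w j) ∂ν) z
      = ∫ w, φ w * (∏ k, a w k ^ i k) * Complex.exp (∑ j, z j * a w j) ∂ν := by
  rw [multiPow, (h.foldr_dz i _).2]
  simp only [Fin.prod_univ_def]

lemma ExpMoments.mul_list_prod (h : ExpMoments ν a φ) (z : Fin n → ℂ) (l : List (Fin n)) :
    ExpMoments ν a (fun w => φ w * (l.map fun j => conj (z j) - a w j).prod) := by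
  induction l with
  | nil => simpa using h
  | cons j l ih =>
    have := (ih.const_mul (conj (z j))).sub (ih.mul j)
    convert this using 2 with w
    simp only [List.map_cons, List.prod_cons]; ring

lemma ExpMoments.integral_cons (h : ExpMoments ν a φ) (z : Fin n → ℂ) (j : Fin n)
    (l : List (Fin n)) :
    ∫ w, φ w * ((j :: l).map fun j => conj (z j) - a w j).prod
          * Complex.exp (∑ k, z k * a w k) ∂ν
      = conj (z j) * (∫ w, φ w * (l.map fun j => conj (z j) - a w j).prod
          * Complex.exp (∑ k, z k * a w k) ∂ν)
        - ∫ w, φ w * a w j * (l.map fun j => conj (z j) - a w j).prod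
          * Complex.exp (∑ k, z k * a w k) ∂ν := by
  rw [← integral_const_mul, ← integral_sub]
  · congr with w
    simp only [List.map_cons, List.prod_cons]; ring
  · exact ((h.mul_list_prod z l).integrable z).const_mul _
  · exact ((h.mul j).mul_list_prod z l).integrable z

lemma ExpMoments.dz_list_prod (h : ExpMoments ν a φ) (l : List (Fin n)) (z : Fin n → ℂ) :
    DifferentiableAt ℝ (fun ζ => ∫ w, φ w * (l.map fun j => conj (ζ j) - a w j).prod
      * Complex.exp (∑ k, ζ k * a w k) ∂ν) z ∧
    ∀ k, dz k (fun ζ => ∫ w, φ w * (l.map fun j => conj (ζ j) - a w j).prod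
      * Complex.exp (∑ k, ζ k * a w k) ∂ν) z
      = ∫ w, φ w * a w k * (l.map fun j => conj (z j) - a w j).prod
      * Complex.exp (∑ k, z k * a w k) ∂ν := by
  induction l generalizing φ with
  | nil =>
    simp only [List.map_nil, List.prod_nil, mul_one]
    exact ⟨((h.hasFDerivAt z).restrictScalars ℝ).differentiableAt, fun k => h.dz_eq k z⟩
  | cons j l ih =>
    simp only [fun ζ => h.integral_cons ζ j l]
    have h1 := ih h
    have h2 := ih (h.mul j)
    refine ⟨(differentiableAt_conj_mul h1.1 j).fun_sub h2.1, fun k => ?_⟩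
    rw [dz_sub (differentiableAt_conj_mul h1.1 j) h2.1, dz_conj_mul h1.1, h1.2, h2.2,
      (h.mul k).integral_cons]
    congr 3 with w
    ring

lemma ExpMoments.conjSubDz_list_prod (h : ExpMoments ν a φ) (l : List (Fin n)) (k : Fin n) :
    conjSubDz k (fun ζ => ∫ w, φ w * (l.map fun j => conj (ζ j) - a w j).prod
      * Complex.exp (∑ k, ζ k * a w k) ∂ν)
      = fun ζ => ∫ w, φ w * ((k :: l).map fun j => conj (ζ j) - a w j).prod
      * Complex.exp (∑ k, ζ k * a w k) ∂ν := by
  ext z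
  rw [conjSubDz, (h.dz_list_prod l z).2, h.integral_cons]

lemma ExpMoments.conjSubDz_iterate (h : ExpMoments ν a φ) (l : List (Fin n)) (k : Fin n)
    (m : ℕ) :
    (conjSubDz k)^[m] (fun ζ => ∫ w, φ w * (l.map fun j => conj (ζ j) - a w j).prod
      * Complex.exp (∑ k, ζ k * a w k) ∂ν)
      = fun ζ => ∫ w, φ w * ((List.replicate m k ++ l).map fun j => conj (ζ j) - a w j).prod
      * Complex.exp (∑ k, ζ k * a w k) ∂ν := by
  induction m with
  | zero => rfl
  | succ m ih =>
    rw [Function.iterate_succ_apply', ih, h.conjSubDz_list_prod]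
    rfl

lemma prod_map_flatMap_replicate {ι M : Type*} [CommMonoid M] (b : ι → M) (i : ι → ℕ)
    (l : List ι) : ((l.flatMap fun k => List.replicate (i k) k).map b).prod
      = (l.map fun k => b k ^ i k).prod := by
  induction l with
  | nil => rfl
  | cons k l ih =>
    rw [List.flatMap_cons, List.map_append, List.prod_append, ih, List.map_replicate,
      List.prod_replicate, List.map_cons, List.prod_cons]

lemma ExpMoments.foldr_conjSubDz (h : ExpMoments ν a φ) (i : Fin n → ℕ) (l : List (Fin n)) :
    l.foldr (fun k v => (conjSubDz k)^[i k] v)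
        (fun ζ => ∫ w, φ w * Complex.exp (∑ j, ζ j * a w j) ∂ν)
      = fun ζ => ∫ w, φ w * ((l.flatMap fun k => List.replicate (i k) k).map
          fun j => conj (ζ j) - a w j).prod * Complex.exp (∑ j, ζ j * a w j) ∂ν := by
  induction l with
  | nil => simp
  | cons k l ih =>
    rw [List.foldr_cons, ih, h.conjSubDz_iterate, List.flatMap_cons]

lemma ExpMoments.multiPow_conjSubDz (h : ExpMoments ν a φ) (i : Fin n → ℕ) (z : Fin n → ℂ) :
    multiPow conjSubDz i (fun ζ => ∫ w, φ w * Complex.exp (∑ j, ζ j * a w j) ∂ν) z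
      = ∫ w, φ w * (∏ k, (conj (z k) - a w k) ^ i k) * Complex.exp (∑ j, z j * a w j) ∂ν := by
  rw [multiPow, h.foldr_conjSubDz i]
  simp only [prod_map_flatMap_replicate, Fin.prod_univ_def]

end ExpIntegral

section ExpSeries

lemma hasSum_pi_exp {n : ℕ} (y : Fin n → ℂ) :
    (Summable fun i : Fin n → ℕ => ∏ k, ‖y k ^ i k / ((i k).factorial : ℂ)‖) ∧
    HasSum (fun i : Fin n → ℕ => ∏ k, y k ^ i k / ((i k).factorial : ℂ))
      (Complex.exp (∑ k, y k)) := by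
  induction n with
  | zero => exact ⟨Summable.of_finite, by simp⟩
  | succ n ih =>
    obtain ⟨h1, h2⟩ := ih fun k => y k.succ
    have h3 : HasSum (fun m : ℕ => y 0 ^ m / (m.factorial : ℂ)) (Complex.exp (y 0)) := by
      rw [Complex.exp_eq_exp_ℂ]
      exact NormedSpace.expSeries_div_hasSum_exp (y 0)
    have h4 : Summable fun m : ℕ => ‖y 0 ^ m / (m.factorial : ℂ)‖ :=
      NormedSpace.norm_expSeries_div_summable (y 0)
    have h1' : Summable fun i : Fin n → ℕ =>
        ‖∏ k, y k.succ ^ i k / ((i k).factorial : ℂ)‖ := by simpa [norm_prod] using h1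
    constructor
    · rw [← (Fin.consEquiv fun _ : Fin (n + 1) => ℕ).summable_iff]
      have := h4.mul_norm h1'
      refine this.congr fun p => ?_
      simp only [Fin.consEquiv, Function.comp_apply, Equiv.coe_fn_mk, Fin.prod_univ_succ,
        Fin.cons_zero, Fin.cons_succ, norm_mul, norm_prod]
    · rw [← (Fin.consEquiv fun _ : Fin (n + 1) => ℕ).hasSum_iff]
      have h5 : Summable fun p : ℕ × (Fin n → ℕ) => y 0 ^ p.1 / (p.1.factorial : ℂ)
          * ∏ k, y k.succ ^ p.2 k / ((p.2 k).factorial : ℂ) :=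
        (h4.mul_norm h1').of_norm
      rw [Fin.sum_univ_succ, Complex.exp_add]
      have h6 : (fun i : Fin (n + 1) → ℕ => ∏ k, y k ^ i k / ((i k).factorial : ℂ)) ∘
          (Fin.consEquiv fun _ : Fin (n + 1) => ℕ) = fun p => y 0 ^ p.1 / (p.1.factorial : ℂ)
          * ∏ k, y k.succ ^ p.2 k / ((p.2 k).factorial : ℂ) := by
        funext p
        simp only [Fin.consEquiv, Function.comp_apply, Equiv.coe_fn_mk, Fin.prod_univ_succ,
          Fin.cons_zero, Fin.cons_succ]
      rw [h6]
      have h7 := h3.mul h2 h5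
      convert h7

/-- Termwise integration of the exponential series in several variables. -/
lemma hasSum_integral_exp {n : ℕ} {α : Type*} [MeasurableSpace α] {ν : Measure α} {φ : α → ℂ}
    {y : α → Fin n → ℂ} (hφ : AEStronglyMeasurable φ ν) (hy : Measurable y)
    (hint : Integrable (fun w => ‖φ w‖ * Real.exp (∑ k, ‖y w k‖)) ν) :
    HasSum (fun i : Fin n → ℕ => ∫ w, φ w * ∏ k, y w k ^ i k / ((i k).factorial : ℂ) ∂ν)
      (∫ w, φ w * Complex.exp (∑ k, y w k) ∂ν) := by
  have hbd : ∀ w, ∀ s : Finset (Fin n → ℕ),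
      ∑ i ∈ s, ‖φ w * ∏ k, y w k ^ i k / ((i k).factorial : ℂ)‖
        ≤ ‖φ w‖ * Real.exp (∑ k, ‖y w k‖) := by
    intro w s
    simp only [norm_mul, ← Finset.mul_sum, norm_prod]
    gcongr
    have h := (hasSum_pi_exp fun k => (‖y w k‖ : ℂ)).2
    have h3 : HasSum (fun i : Fin n → ℕ => ∏ k, ‖y w k ^ i k / ((i k).factorial : ℂ)‖)
        (Real.exp (∑ k, ‖y w k‖)) := by
      rw [← Complex.hasSum_ofReal]
      convert h using 2 with i
      · simp
      · simp
    exact sum_le_hasSum s (fun i _ => by positivity) h3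
  have hi : ∀ i : Fin n → ℕ, Integrable
      (fun w => φ w * ∏ k, y w k ^ i k / ((i k).factorial : ℂ)) ν := by
    intro i
    refine hint.mono' (hφ.mul (by fun_prop)) (Filter.Eventually.of_forall fun w => ?_)
    simpa using hbd w {i}
  have := hasSum_integral_of_summable_integral_norm hi
    (summable_of_sum_le (c := ∫ w, ‖φ w‖ * Real.exp (∑ k, ‖y w k‖) ∂ν)
      (fun i => integral_nonneg fun w => norm_nonneg _) fun s => by
        rw [← integral_finsetSum _ fun i _ => (hi i).norm]
        exact integral_mono (integrable_finsetSum _ fun i _ => (hi i).norm) hint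
          fun w => hbd w s)
  have ht : ∀ w, ∑' i : Fin n → ℕ, φ w * ∏ k, y w k ^ i k / ((i k).factorial : ℂ)
      = φ w * Complex.exp (∑ k, y w k) := fun w => by
    rw [tsum_mul_left, (hasSum_pi_exp (y w)).2.tsum_eq]
  simpa only [ht] using this

end ExpSeries

section Growth

variable {n : ℕ}

/-- An entire function of growth at most `C exp (|z|² / 16)`. -/
structure EntireGrowth (C : ℝ) (f : (Fin n → ℂ) → ℂ) : Prop where
  diff : Differentiable ℂ f
  bound : ∀ z, ‖f z‖ ≤ C * Real.exp (1 / 16 * absSq z)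

lemma EntireGrowth.nonneg {C : ℝ} {f : (Fin n → ℂ) → ℂ} (hf : EntireGrowth C f) : 0 ≤ C :=
  nonneg_of_mul_nonneg_left ((norm_nonneg _).trans (hf.bound 0)) (Real.exp_pos _)

lemma exists_entireGrowth {f : (Fin n → ℂ) → ℂ} (hf : f ∈ entireSym n) :
    ∃ C, EntireGrowth C f := by
  obtain ⟨hd, hs⟩ := hf
  have h16 : f ∈ growthSpace n (1 / 16) := by
    simp only [symSpace, Set.mem_iInter] at hs
    exact hs _ (by norm_num)
  obtain ⟨_, C, hC⟩ := h16
  have hd' : Differentiable ℂ f := hd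
  refine ⟨C, hd, fun z => ?_⟩
  have hcl : IsClosed {z | ‖f z‖ * Real.exp (-(1 / 16 * absSq z)) ≤ C} := by
    have := hd'.continuous
    exact isClosed_le (by fun_prop) continuous_const
  have hall : {z | ‖f z‖ * Real.exp (-(1 / 16 * absSq z)) ≤ C} = Set.univ := by
    rw [← hcl.closure_eq]
    exact (Measure.dense_of_ae hC).closure_eq
  have hz : ‖f z‖ * Real.exp (-(1 / 16 * absSq z)) ≤ C :=
    Set.eq_univ_iff_forall.1 hall z
  calc ‖f z‖ = ‖f z‖ * Real.exp (-(1 / 16 * absSq z)) * Real.exp (1 / 16 * absSq z) := by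
        rw [mul_assoc, ← Real.exp_add]; simp
    _ ≤ _ := by gcongr

lemma expMoments_of_growth {φ : (Fin n → ℂ) → ℂ} {a : (Fin n → ℂ) → Fin n → ℂ}
    (hφ : AEStronglyMeasurable φ (gaussian n)) (ha : Measurable a)
    (hnorm : ∀ w k, ‖a w k‖ = ‖w k‖) {C c : ℝ} (hc : c < 1)
    (h : ∀ w, ‖φ w‖ ≤ C * Real.exp (c * absSq w)) : ExpMoments (gaussian n) a φ := by
  have hC : 0 ≤ C := nonneg_of_mul_nonneg_left ((norm_nonneg _).trans (h 0)) (Real.exp_pos _)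
  refine ⟨hφ, ha, fun R => ?_⟩
  set δ := (1 - c) / 2 with hδ
  have hδ0 : 0 < δ := by rw [hδ]; linarith
  set ε := δ / (|R| + 1) with hε
  have hε0 : 0 < ε := by positivity
  refine integrable_of_growth (C := C * Real.exp (|R| * ((4 * ε)⁻¹ * n))) (c := c + δ)
    (hφ.norm.mul (by fun_prop)) (by rw [hδ]; linarith) fun w => ?_
  rw [Real.norm_of_nonneg (by positivity)]
  have h1 : R * ∑ k, ‖a w k‖ ≤ δ * absSq w + |R| * ((4 * ε)⁻¹ * n) := by
    simp_rw [hnorm]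
    have h2 : R * ∑ k, ‖w k‖ ≤ |R| * (ε * absSq w + (4 * ε)⁻¹ * n) :=
      mul_le_mul (le_abs_self R) (sum_norm_le hε0 w) (by positivity) (abs_nonneg R)
    have h3 : |R| * ε ≤ δ := by
      rw [hε, mul_div_assoc', div_le_iff₀ (by positivity)]
      nlinarith [abs_nonneg R]
    have h4 := mul_le_mul_of_nonneg_right h3 (absSq_nonneg w)
    nlinarith
  refine (mul_le_mul (h w) (Real.exp_le_exp.2 h1) (by positivity) (by positivity)).trans_eq ?_
  rw [mul_assoc, mul_assoc, ← Real.exp_add, ← Real.exp_add]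
  congr 2; ring

lemma integrable_prod_of_growth {Φ : (Fin n → ℂ) × (Fin n → ℂ) → ℂ}
    (hΦ : AEStronglyMeasurable Φ ((gaussian n).prod (gaussian n))) {C c₁ c₂ : ℝ}
    (hc₁ : c₁ < 1) (hc₂ : c₂ < 1)
    (h : ∀ p, ‖Φ p‖ ≤ C * (Real.exp (c₁ * absSq p.1) * Real.exp (c₂ * absSq p.2))) :
    Integrable Φ ((gaussian n).prod (gaussian n)) :=
  (((integrable_exp_mul_absSq hc₁).mul_prod (integrable_exp_mul_absSq hc₂)).const_mul C).mono' hΦ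
    (Filter.Eventually.of_forall h)

end Growth

section Series

variable {n : ℕ} {f g : (Fin n → ℂ) → ℂ} {Cf Cg : ℝ}

/-- The integral which represents `g*(ζ̄ - ∂) f`. -/
noncomputable def invBerezin (f g : (Fin n → ℂ) → ℂ) (z : Fin n → ℂ) : ℂ :=
  ∫ v, f (z + v) * conj (g (-v)) * Complex.exp (-herm v z) ∂(gaussian n)

lemma EntireGrowth.eq_integral (hf : EntireGrowth Cf f) (z : Fin n → ℂ) :
    ∫ w, f w * Complex.exp (herm z w) ∂(gaussian n) = f z :=
  integral_mul_exp_herm hf.diff (by norm_num) (by norm_num) hf.bound z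

lemma EntireGrowth.conj_eq_integral (hg : EntireGrowth Cg g) (z : Fin n → ℂ) :
    ∫ w, conj (g w) * Complex.exp (herm w z) ∂(gaussian n) = conj (g z) := by
  rw [← hg.eq_integral z, ← integral_conj]
  congr with w
  rw [map_mul, ← Complex.exp_conj, conj_herm]

lemma EntireGrowth.expMoments (hf : EntireGrowth Cf f) :
    ExpMoments (gaussian n) (fun w k => conj (w k)) f :=
  expMoments_of_growth hf.diff.continuous.aestronglyMeasurable (by fun_prop) (by simp)
    (by norm_num : (1 / 16 : ℝ) < 1) hf.bound

lemma EntireGrowth.expMoments_conj (hg : EntireGrowth Cg g) :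
    ExpMoments (gaussian n) (fun w => w) (fun w => conj (g w)) := by
  have := hg.diff.continuous
  refine expMoments_of_growth (Continuous.aestronglyMeasurable (by fun_prop)) (by fun_prop)
    (by simp) (by norm_num : (1 / 16 : ℝ) < 1) (C := Cg) ?_
  simpa using hg.bound

lemma EntireGrowth.multiPow_conjSubDz (hf : EntireGrowth Cf f) (i : Fin n → ℕ)
    (z : Fin n → ℂ) :
    multiPow conjSubDz i f z
      = ∫ w, f w * Complex.exp (herm z w) * ∏ k, (conj (z k) - conj (w k)) ^ i k
          ∂(gaussian n) := by
  have h := hf.expMoments.multiPow_conjSubDz i z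
  have hf' : (fun ζ => ∫ w, f w * Complex.exp (∑ j, ζ j * conj (w j)) ∂(gaussian n)) = f :=
    funext hf.eq_integral
  rw [hf'] at h
  rw [h]
  congr with w
  rw [herm]; ring

lemma EntireGrowth.taylorCoeff_conjStar (hg : EntireGrowth Cg g) (i : Fin n → ℕ) :
    taylorCoeff (conjStar g) i
      = (∫ y, conj (g y) * ∏ k, y k ^ i k ∂(gaussian n)) / ((∏ k, (i k).factorial : ℕ) : ℂ) := by
  have h := hg.expMoments_conj.multiPow_dz i 0
  have hg' : (fun ζ => ∫ w, conj (g w) * Complex.exp (∑ j, ζ j * w j) ∂(gaussian n))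
      = conjStar g := by
    funext ζ
    rw [conjStar, ← hg.conj_eq_integral]
    congr with w
    simp [herm, mul_comm]
  rw [hg'] at h
  rw [taylorCoeff, h]
  simp

lemma EntireGrowth.opTerm_eq (hf : EntireGrowth Cf f) (hg : EntireGrowth Cg g)
    (z : Fin n → ℂ) (i : Fin n → ℕ) :
    opTerm (conjStar g) f z i
      = ∫ p : (Fin n → ℂ) × (Fin n → ℂ), (conj (g p.1) * (f p.2 * Complex.exp (herm z p.2)))
          * ∏ k, (p.1 k * (conj (z k) - conj (p.2 k))) ^ i k / ((i k).factorial : ℂ)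
          ∂((gaussian n).prod (gaussian n)) := by
  rw [opTerm, hf.multiPow_conjSubDz, hg.taylorCoeff_conjStar, div_mul_eq_mul_div,
    ← integral_prod_mul, ← integral_div]
  congr with p
  simp only [mul_pow, Finset.prod_div_distrib, Finset.prod_mul_distrib, Nat.cast_prod]
  ring

lemma EntireGrowth.norm_integrand_le (hf : EntireGrowth Cf f) (hg : EntireGrowth Cg g)
    (z y w : Fin n → ℂ) :
    ‖conj (g y) * (f w * Complex.exp (herm z w))‖
        * Real.exp (∑ k, ‖y k * (conj (z k) - conj (w k))‖)
      ≤ Cg * Cf * Real.exp ((2 + 5 / 2) * absSq z)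
        * (Real.exp (9 / 16 * absSq y) * Real.exp (13 / 16 * absSq w)) := by
  have hCf := hf.nonneg
  have hCg := hg.nonneg
  have h1 : ∑ k, ‖y k * (conj (z k) - conj (w k))‖
      ≤ 1 / 2 * absSq y + (5 / 8 * absSq w + 5 / 2 * absSq z) := by
    have e1 : ∀ k, ‖y k * (conj (z k) - conj (w k))‖ = ‖y k‖ * ‖(-w + z) k‖ := fun k => by
      rw [norm_mul, ← map_sub, RCLike.norm_conj]; simp [neg_add_eq_sub]
    simp_rw [e1]
    have e2 := sum_norm_mul_norm_le (by norm_num : (0 : ℝ) < 1 / 2) y (-w + z)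
    have e3 := absSq_add_le (by norm_num : (0 : ℝ) < 1 / 4) (-w) z
    rw [absSq_neg] at e3
    refine e2.trans ?_
    norm_num at e3 ⊢
    linarith
  have h2 : ‖herm z w‖ ≤ 2 * absSq z + 1 / 8 * absSq w := by
    have := norm_herm_le (by norm_num : (0 : ℝ) < 2) z w
    norm_num at this ⊢
    exact this
  have h3 : ‖Complex.exp (herm z w)‖ ≤ Real.exp (2 * absSq z + 1 / 8 * absSq w) :=
    (Complex.norm_exp_le_exp_norm _).trans (Real.exp_le_exp.2 h2)
  rw [norm_mul, norm_mul, RCLike.norm_conj]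
  calc ‖g y‖ * (‖f w‖ * ‖Complex.exp (herm z w)‖)
        * Real.exp (∑ k, ‖y k * (conj (z k) - conj (w k))‖)
      ≤ Cg * Real.exp (1 / 16 * absSq y) * (Cf * Real.exp (1 / 16 * absSq w)
        * Real.exp (2 * absSq z + 1 / 8 * absSq w))
        * Real.exp (1 / 2 * absSq y + (5 / 8 * absSq w + 5 / 2 * absSq z)) := by
        gcongr
        · exact hg.bound y
        · exact hf.bound w
    _ = Cg * Cf * (Real.exp (1 / 16 * absSq y) * (Real.exp (1 / 16 * absSq w)
        * Real.exp (2 * absSq z + 1 / 8 * absSq w))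
        * Real.exp (1 / 2 * absSq y + (5 / 8 * absSq w + 5 / 2 * absSq z))) := by ring
    _ = _ := by
        rw [mul_assoc (Cg * Cf)]
        simp only [← Real.exp_add]
        congr 2; ring

lemma EntireGrowth.hasSum_opTerm (hf : EntireGrowth Cf f) (hg : EntireGrowth Cg g)
    (z : Fin n → ℂ) : HasSum (opTerm (conjStar g) f z) (invBerezin f g z) := by
  have hfc := hf.diff.continuous
  have hgc := hg.diff.continuous
  have hsum := hasSum_integral_exp (ν := (gaussian n).prod (gaussian n))
    (φ := fun p => conj (g p.1) * (f p.2 * Complex.exp (herm z p.2)))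
    (y := fun p k => p.1 k * (conj (z k) - conj (p.2 k)))
    (Continuous.aestronglyMeasurable (by fun_prop)) (by fun_prop) (by
      have := ((integrable_exp_mul_absSq (n := n) (by norm_num : (9 / 16 : ℝ) < 1)).mul_prod
        (integrable_exp_mul_absSq (n := n) (by norm_num : (13 / 16 : ℝ) < 1))).const_mul
          (Cg * Cf * Real.exp ((2 + 5 / 2) * absSq z))
      refine this.mono' (Continuous.aestronglyMeasurable (by fun_prop))
        (Filter.Eventually.of_forall fun p => ?_)
      rw [Real.norm_of_nonneg (by positivity)]
      exact hf.norm_integrand_le hg z p.1 p.2)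
  have hint : Integrable (fun p : (Fin n → ℂ) × (Fin n → ℂ) =>
      (conj (g p.1) * (f p.2 * Complex.exp (herm z p.2)))
        * Complex.exp (∑ k, p.1 k * (conj (z k) - conj (p.2 k))))
      ((gaussian n).prod (gaussian n)) := by
    refine integrable_prod_of_growth (Continuous.aestronglyMeasurable (by fun_prop))
      (by norm_num : (9 / 16 : ℝ) < 1) (by norm_num : (13 / 16 : ℝ) < 1)
      (C := Cg * Cf * Real.exp ((2 + 5 / 2) * absSq z)) fun p => ?_
    refine le_trans ?_ (hf.norm_integrand_le hg z p.1 p.2)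
    rw [norm_mul]
    gcongr
    exact (Complex.norm_exp_le_exp_norm _).trans (Real.exp_le_exp.2 (norm_sum_le _ _))
  have hval : ∫ p : (Fin n → ℂ) × (Fin n → ℂ),
      (conj (g p.1) * (f p.2 * Complex.exp (herm z p.2)))
        * Complex.exp (∑ k, p.1 k * (conj (z k) - conj (p.2 k)))
      ∂((gaussian n).prod (gaussian n)) = invBerezin f g z := by
    rw [integral_prod_symm _ hint]
    have hin : ∀ w, ∫ y, (conj (g y) * (f w * Complex.exp (herm z w)))
        * Complex.exp (∑ k, y k * (conj (z k) - conj (w k))) ∂(gaussian n)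
        = f w * Complex.exp (herm z w) * conj (g (z - w)) := by
      intro w
      rw [← hg.conj_eq_integral, ← integral_const_mul]
      congr with y
      simp only [herm, Pi.sub_apply, map_sub]
      ring
    simp_rw [hin]
    rw [integral_gaussian_translate _ z, invBerezin]
    congr with v
    have e1 : z - (z + v) = -v := by abel
    have e2 : Complex.exp (-herm v z) = Complex.exp (herm z (z + v))
        * Complex.exp (-herm v z - herm z v - herm z z) := by
      rw [← Complex.exp_add, herm_add_right]; congr 1; ring
    rw [e1, e2]; ring
  rw [← hval]
  convert hsum using 1
  funext i
  exact hf.opTerm_eq hg z i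

end Series

section Solution

variable {n : ℕ} {f g : (Fin n → ℂ) → ℂ} {Cf Cg : ℝ}

lemma EntireGrowth.norm_invBerezin_integrand_le (hf : EntireGrowth Cf f)
    (hg : EntireGrowth Cg g) (z v : Fin n → ℂ) :
    ‖f (z + v) * conj (g (-v)) * Complex.exp (-herm v z)‖
      ≤ Cf * Cg * (Real.exp (15 / 16 * absSq v) * Real.exp (11 / 24 * absSq z)) := by
  have hCf := hf.nonneg
  have hCg := hg.nonneg
  have h1 : absSq (z + v) ≤ 2 * absSq z + 2 * absSq v := by
    have := absSq_add_le one_pos z v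
    norm_num at this; linarith
  have h2 : ‖herm v z‖ ≤ 3 / 4 * absSq v + 1 / 3 * absSq z := by
    have := norm_herm_le (by norm_num : (0 : ℝ) < 3 / 4) v z
    norm_num at this ⊢; linarith
  have h3 : ‖Complex.exp (-herm v z)‖ ≤ Real.exp (3 / 4 * absSq v + 1 / 3 * absSq z) := by
    refine (Complex.norm_exp_le_exp_norm _).trans (Real.exp_le_exp.2 ?_)
    rwa [norm_neg]
  rw [norm_mul, norm_mul, RCLike.norm_conj]
  calc ‖f (z + v)‖ * ‖g (-v)‖ * ‖Complex.exp (-herm v z)‖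
      ≤ Cf * Real.exp (1 / 16 * (2 * absSq z + 2 * absSq v))
        * (Cg * Real.exp (1 / 16 * absSq v))
        * Real.exp (3 / 4 * absSq v + 1 / 3 * absSq z) := by
        gcongr
        · exact (hf.bound _).trans (by gcongr)
        · exact (hg.bound _).trans_eq (by rw [absSq_neg])
    _ = Cf * Cg * (Real.exp (1 / 16 * (2 * absSq z + 2 * absSq v))
        * Real.exp (1 / 16 * absSq v) * Real.exp (3 / 4 * absSq v + 1 / 3 * absSq z)) := by ring
    _ = _ := by
        simp only [← Real.exp_add]
        congr 2; ring

lemma EntireGrowth.norm_invBerezin_le (hf : EntireGrowth Cf f) (hg : EntireGrowth Cg g) :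
    ∃ C, ∀ z, ‖invBerezin f g z‖ ≤ C * Real.exp (11 / 24 * absSq z) := by
  refine ⟨Cf * Cg * ∫ v : Fin n → ℂ, Real.exp (15 / 16 * absSq v) ∂(gaussian n), fun z => ?_⟩
  have hi := integrable_exp_mul_absSq (n := n) (by norm_num : (15 / 16 : ℝ) < 1)
  refine (norm_integral_le_of_norm_le ((hi.mul_const (Real.exp (11 / 24 * absSq z))).const_mul
    (Cf * Cg)) (Filter.Eventually.of_forall fun v =>
      hf.norm_invBerezin_integrand_le hg z v)).trans_eq ?_
  rw [integral_const_mul, integral_mul_const]; ring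

lemma stronglyMeasurable_invBerezin (hf : Continuous f) (hg : Continuous g) :
    StronglyMeasurable (invBerezin f g) := by
  refine StronglyMeasurable.integral_prod_right (ν := gaussian n)
    (f := fun z v => f (z + v) * conj (g (-v)) * Complex.exp (-herm v z)) ?_
  refine Continuous.stronglyMeasurable ?_
  simp only [Function.uncurry_def]
  fun_prop

lemma EntireGrowth.memLp_invBerezin (hf : EntireGrowth Cf f) (hg : EntireGrowth Cg g) :
    MemLp (invBerezin f g) 2 (gaussian n) := by
  have hm := (stronglyMeasurable_invBerezin hf.diff.continuous hg.diff.continuous)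
  obtain ⟨C, hC⟩ := hf.norm_invBerezin_le hg
  rw [← memLp_norm_iff hm.aestronglyMeasurable,
    memLp_two_iff_integrable_sq hm.aestronglyMeasurable.norm]
  refine integrable_of_growth (hm.aestronglyMeasurable.norm.pow 2)
    (by norm_num : (11 / 12 : ℝ) < 1) (C := C ^ 2) fun w => ?_
  rw [norm_pow, norm_norm]
  refine (pow_le_pow_left₀ (norm_nonneg _) (hC w) 2).trans_eq ?_
  rw [mul_pow, ← Real.exp_nat_mul]
  congr 2; push_cast; ring

lemma EntireGrowth.translate (hf : EntireGrowth Cf f) (z : Fin n → ℂ) :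
    ∃ C, ∀ w, ‖f (z + w)‖ ≤ C * Real.exp (1 / 8 * absSq w) := by
  have hCf := hf.nonneg
  refine ⟨Cf * Real.exp (1 / 8 * absSq z), fun w => (hf.bound _).trans ?_⟩
  have h1 : absSq (z + w) ≤ 2 * absSq z + 2 * absSq w := by
    have := absSq_add_le one_pos z w
    norm_num at this; linarith
  rw [mul_assoc, ← Real.exp_add]
  gcongr
  linarith

lemma EntireGrowth.integrable_translate_invBerezin (hf : EntireGrowth Cf f)
    (hg : EntireGrowth Cg g) (z : Fin n → ℂ) :
    Integrable (fun w => invBerezin f g (z + w)) (gaussian n) := by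
  have hm := (stronglyMeasurable_invBerezin hf.diff.continuous hg.diff.continuous)
  obtain ⟨C, hC⟩ := hf.norm_invBerezin_le hg
  have hC0 : 0 ≤ C := nonneg_of_mul_nonneg_left ((norm_nonneg _).trans (hC 0)) (Real.exp_pos _)
  refine integrable_of_growth
    (hm.measurable.comp (measurable_const_add z)).aestronglyMeasurable
    (by norm_num : (11 / 12 : ℝ) < 1) (C := C * Real.exp (11 / 12 * absSq z)) fun w => ?_
  refine (hC _).trans ?_
  have h1 : absSq (z + w) ≤ 2 * absSq z + 2 * absSq w := by
    have := absSq_add_le one_pos z w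
    norm_num at this; linarith
  rw [mul_assoc, ← Real.exp_add]
  gcongr
  linarith

lemma EntireGrowth.berezin_invBerezin (hf : EntireGrowth Cf f) (hg : EntireGrowth Cg g)
    (z : Fin n → ℂ) : berezin (invBerezin f g) z = f z * conj (g z) := by
  have hfc := hf.diff.continuous
  have hgc := hg.diff.continuous
  have hCf := hf.nonneg
  have hCg := hg.nonneg
  rw [berezin_eq_integral_translate]
  simp only [invBerezin]
  have hint : Integrable (Function.uncurry fun (w v : Fin n → ℂ) =>
      f (z + w + v) * conj (g (-v)) * Complex.exp (-herm v (z + w)))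
      ((gaussian n).prod (gaussian n)) := by
    refine integrable_prod_of_growth (Continuous.aestronglyMeasurable ?_)
      (by norm_num : (11 / 16 : ℝ) < 1) (by norm_num : (7 / 8 : ℝ) < 1)
      (C := Cf * Cg * Real.exp ((3 / 16 + 2) * absSq z)) fun p => ?_
    · simp only [Function.uncurry_def]; fun_prop
    obtain ⟨w, v⟩ := p
    simp only [Function.uncurry_apply_pair]
    have h1 : absSq (z + w + v) ≤ 3 * absSq z + 3 * absSq w + 3 * absSq v := by
      have e1 := absSq_add_le (by norm_num : (0 : ℝ) < 1 / 2) (z + w) v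
      have e2 := absSq_add_le one_pos z w
      norm_num at e1 e2; linarith
    have h2 : ‖herm v (z + w)‖ ≤ 5 / 8 * absSq v + 1 / 2 * absSq w + 2 * absSq z := by
      have e1 := norm_herm_le (by norm_num : (0 : ℝ) < 1 / 2) v w
      have e2 := norm_herm_le (by norm_num : (0 : ℝ) < 1 / 8) v z
      have e3 := norm_add_le (herm v z) (herm v w)
      rw [herm_add_right]
      norm_num at e1 e2; linarith
    have h3 : ‖Complex.exp (-herm v (z + w))‖
        ≤ Real.exp (5 / 8 * absSq v + 1 / 2 * absSq w + 2 * absSq z) := by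
      refine (Complex.norm_exp_le_exp_norm _).trans (Real.exp_le_exp.2 ?_)
      rwa [norm_neg]
    rw [norm_mul, norm_mul, RCLike.norm_conj]
    calc ‖f (z + w + v)‖ * ‖g (-v)‖ * ‖Complex.exp (-herm v (z + w))‖
        ≤ Cf * Real.exp (1 / 16 * (3 * absSq z + 3 * absSq w + 3 * absSq v))
          * (Cg * Real.exp (1 / 16 * absSq v))
          * Real.exp (5 / 8 * absSq v + 1 / 2 * absSq w + 2 * absSq z) := by
          gcongr
          · exact (hf.bound _).trans (by gcongr)
          · exact (hg.bound _).trans_eq (by rw [absSq_neg])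
      _ = Cf * Cg * (Real.exp (1 / 16 * (3 * absSq z + 3 * absSq w + 3 * absSq v))
          * Real.exp (1 / 16 * absSq v)
          * Real.exp (5 / 8 * absSq v + 1 / 2 * absSq w + 2 * absSq z)) := by ring
      _ = _ := by
          rw [mul_assoc (Cf * Cg)]
          simp only [← Real.exp_add]
          congr 2; ring
  rw [integral_integral_swap hint]
  have hin : ∀ v, ∫ w, f (z + w + v) * conj (g (-v)) * Complex.exp (-herm v (z + w)) ∂(gaussian n)
      = f z * (conj (g (-v)) * Complex.exp (-herm v z)) := by
    intro v
    obtain ⟨C, hC⟩ := hf.translate (z + v)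
    have hd : Differentiable ℂ fun w => f (z + v + w) := by
      have := hf.diff
      fun_prop
    have h := integral_mul_exp_herm hd (by norm_num) (by norm_num) hC (-v)
    simp only [add_neg_cancel_right] at h
    rw [← h, ← integral_mul_const]
    congr with w
    have e : Complex.exp (-herm v (z + w))
        = Complex.exp (herm (-v) w) * Complex.exp (-herm v z) := by
      rw [← Complex.exp_add, herm_add_right, herm_neg_left]; congr 1; ring
    rw [e, add_right_comm]; ring
  simp_rw [hin]
  rw [integral_const_mul]
  congr 1
  have hgn : EntireGrowth Cg fun v => g (-v) :=
    ⟨by have := hg.diff; fun_prop, fun v => (hg.bound _).trans_eq (by rw [absSq_neg])⟩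
  have h := hgn.conj_eq_integral (-z)
  simp only [neg_neg] at h
  rw [← h]
  congr with v
  rw [← conj_herm (-z), herm_neg_left, map_neg, conj_herm]

end Solution

section Injectivity

open ProbabilityTheory

variable {n : ℕ}

lemma exists_herm_eq_dual (L : StrongDual ℝ (Fin n → ℂ)) :
    ∃ z, ∀ w, herm w z + herm z w = (L w : ℂ) := by
  refine ⟨fun k => ⟨L (Pi.single k 1) / 2, L (Pi.single k Complex.I) / 2⟩, fun w => ?_⟩
  have hw : w = ∑ k, ((w k).re • (Pi.single k 1 : Fin n → ℂ)
      + (w k).im • (Pi.single k Complex.I : Fin n → ℂ)) := by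
    have h1 : ∀ k, (w k).re • (Pi.single k 1 : Fin n → ℂ)
      + (w k).im • (Pi.single k Complex.I : Fin n → ℂ) = Pi.single k (w k) := fun k => by
      rw [← Pi.single_smul, ← Pi.single_smul, ← Pi.single_add]
      congr 1
      simp [Complex.re_add_im]
    simp_rw [h1]
    exact (Finset.univ_sum_single w).symm
  have hL : L w = ∑ k, ((w k).re * L (Pi.single k 1) + (w k).im * L (Pi.single k Complex.I)) := by
    conv_lhs => rw [hw]
    simp only [map_sum, map_add, map_smul, smul_eq_mul]
  rw [hL]
  simp only [herm, ← Finset.sum_add_distrib, Complex.ofReal_sum]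
  refine Finset.sum_congr rfl fun k _ => ?_
  apply Complex.ext <;> simp <;> ring

lemma exists_dual_eq_herm (z : Fin n → ℂ) :
    ∃ L : StrongDual ℝ (Fin n → ℂ), ∀ w, herm w z + herm z w = (L w : ℂ) := by
  refine ⟨∑ k, (2 * (z k).re) • Complex.reCLM.comp (ContinuousLinearMap.proj k)
    + ∑ k, (2 * (z k).im) • Complex.imCLM.comp (ContinuousLinearMap.proj k), fun w => ?_⟩
  simp only [herm, ← Finset.sum_add_distrib, add_apply, sum_apply, smul_apply,
    ContinuousLinearMap.comp_apply, ContinuousLinearMap.proj_apply, Complex.ofReal_sum]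
  refine Finset.sum_congr rfl fun k _ => ?_
  apply Complex.ext <;> simp <;> ring

lemma memLp_exp_dual (L : StrongDual ℝ (Fin n → ℂ)) :
    MemLp (fun w => Real.exp (L w)) 2 (gaussian n) := by
  have hLc := L.continuous
  rw [memLp_two_iff_integrable_sq (Continuous.aestronglyMeasurable (by fun_prop))]
  have h := (expMoments_of_growth (n := n) (φ := fun _ => 1) (a := fun w => w) (by fun_prop)
    (by fun_prop) (by simp) one_half_lt_one (C := 1) fun w => by
      simpa using mul_nonneg (by norm_num : (0 : ℝ) ≤ 1 / 2) (absSq_nonneg w)).int (2 * ‖L‖)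
  refine h.mono' (Continuous.aestronglyMeasurable (by fun_prop))
    (Filter.Eventually.of_forall fun w => ?_)
  rw [Real.norm_of_nonneg (by positivity), ← Real.exp_nat_mul, norm_one, one_mul]
  refine Real.exp_le_exp.2 ?_
  have h1 : L w ≤ ‖L‖ * ‖w‖ := (le_abs_self _).trans (L.le_opNorm w)
  have h2 : ‖w‖ ≤ ∑ k, ‖w k‖ := (pi_norm_le_iff_of_nonneg (by positivity)).2 fun k =>
    Finset.single_le_sum (f := fun k => ‖w k‖) (fun _ _ => norm_nonneg _) (Finset.mem_univ k)
  have h3 := mul_le_mul_of_nonneg_left h2 (norm_nonneg L)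
  push_cast
  linarith

/-- The exponential moments of a finite measure determine it. -/
lemma measure_eq_of_integral_exp_eq {E : Type*} [NormedAddCommGroup E] [NormedSpace ℝ E]
    [CompleteSpace E] [SecondCountableTopology E] [MeasurableSpace E] [BorelSpace E]
    {m₁ m₂ : Measure E} [IsFiniteMeasure m₁] [IsFiniteMeasure m₂]
    (h₁ : ∀ L : StrongDual ℝ E, Integrable (fun w => Real.exp (L w)) m₁)
    (h : ∀ L : StrongDual ℝ E, ∫ w, Real.exp (L w) ∂m₁ = ∫ w, Real.exp (L w) ∂m₂) :
    m₁ = m₂ := by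
  refine Measure.ext_of_charFunDual (funext fun L => ?_)
  have hmgf : mgf L m₁ = mgf L m₂ := by
    funext t
    simpa [mgf] using h (t • L)
  have hzero : m₁ = 0 ↔ m₂ = 0 := by
    have h0 := h 0
    simp only [zero_apply, Real.exp_zero, integral_const, smul_eq_mul,
      mul_one] at h0
    rw [← Measure.measure_univ_eq_zero, ← Measure.measure_univ_eq_zero (μ := m₂),
      ← measureReal_eq_zero_iff, ← measureReal_eq_zero_iff, h0]
  have hset : integrableExpSet L m₁ = Set.univ := by
    ext t
    simpa [integrableExpSet] using h₁ (t • L)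
  have hc := eqOn_complexMGF_of_mgf' hmgf hzero (x := Complex.I) (by simp [hset])
  rw [charFunDual_apply, charFunDual_apply]
  simpa only [complexMGF, mul_comm] using hc

lemma ae_eq_zero_of_integral_mul_exp_eq_zero {v : (Fin n → ℂ) → ℝ}
    (hv : MemLp v 2 (gaussian n))
    (h : ∀ L : StrongDual ℝ (Fin n → ℂ), ∫ w, v w * Real.exp (L w) ∂(gaussian n) = 0) :
    v =ᵐ[gaussian n] 0 := by
  have hint : ∀ L : StrongDual ℝ (Fin n → ℂ),
      Integrable (fun w => v w * Real.exp (L w)) (gaussian n) :=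
    fun L => hv.integrable_mul (memLp_exp_dual L)
  have hpos : ∀ {u : (Fin n → ℂ) → ℝ}, (∀ L : StrongDual ℝ (Fin n → ℂ),
      Integrable (fun w => u w * Real.exp (L w)) (gaussian n)) →
      ∀ L : StrongDual ℝ (Fin n → ℂ),
        Integrable (fun w => max (u w) 0 * Real.exp (L w)) (gaussian n) := by
    intro u hu L
    refine (hu L).pos_part.congr (Filter.Eventually.of_forall fun w => ?_)
    simp only
    rw [max_mul_of_nonneg _ _ (Real.exp_pos _).le, zero_mul]
  have hvm : AEMeasurable v (gaussian n) := hv.1.aemeasurable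
  have hi : Integrable v (gaussian n) := by simpa using hint 0
  set m₁ := (gaussian n).withDensity fun w => ENNReal.ofReal (v w) with hm₁
  set m₂ := (gaussian n).withDensity fun w => ENNReal.ofReal (-v w) with hm₂
  have hfin₁ : ∫⁻ w, ENNReal.ofReal (v w) ∂(gaussian n) ≠ ⊤ := hi.lintegral_lt_top.ne
  have hfin₂ : ∫⁻ w, ENNReal.ofReal (-v w) ∂(gaussian n) ≠ ⊤ := hi.neg.lintegral_lt_top.ne
  have : IsFiniteMeasure m₁ := isFiniteMeasure_withDensity hfin₁
  have : IsFiniteMeasure m₂ := isFiniteMeasure_withDensity hfin₂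
  have hintn : ∀ L : StrongDual ℝ (Fin n → ℂ),
      Integrable (fun w => -v w * Real.exp (L w)) (gaussian n) := fun L => by
    simpa only [neg_mul] using (hint L).fun_neg
  have heq : m₁ = m₂ := by
    refine measure_eq_of_integral_exp_eq (fun L => ?_) fun L => ?_
    · rw [hm₁, integrable_withDensity_iff_integrable_smul₀' hvm.ennreal_ofReal (by simp)]
      simpa only [ENNReal.toReal_ofReal', smul_eq_mul] using hpos hint L
    · rw [hm₁, hm₂, integral_withDensity_eq_integral_toReal_smul₀ hvm.ennreal_ofReal (by simp),
        integral_withDensity_eq_integral_toReal_smul₀ hvm.fun_neg.ennreal_ofReal (by simp)]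
      simp only [ENNReal.toReal_ofReal', smul_eq_mul]
      rw [← sub_eq_zero, ← integral_sub (hpos hint L) (hpos hintn L)]
      refine Eq.trans ?_ (h L)
      congr with w
      rw [← sub_mul]
      congr 1
      rcases le_total (v w) 0 with h0 | h0
      · rw [max_eq_right h0, max_eq_left (by linarith)]; ring
      · rw [max_eq_left h0, max_eq_right (by linarith)]; ring
  rw [hm₁, hm₂, withDensity_eq_iff hvm.ennreal_ofReal hvm.fun_neg.ennreal_ofReal hfin₁] at heq
  filter_upwards [heq] with w hw
  rcases le_total (v w) 0 with h0 | h0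
  · rw [ENNReal.ofReal_of_nonpos h0, eq_comm, ENNReal.ofReal_eq_zero, Left.neg_nonpos_iff] at hw
    exact le_antisymm h0 hw
  · rw [ENNReal.ofReal_of_nonpos (by linarith : -v w ≤ 0), ENNReal.ofReal_eq_zero] at hw
    exact le_antisymm hw h0

lemma integrable_mul_exp_dual {u : (Fin n → ℂ) → ℂ} (hu : MemLp u 2 (gaussian n))
    (L : StrongDual ℝ (Fin n → ℂ)) :
    Integrable (fun w => u w * (Real.exp (L w) : ℂ)) (gaussian n) :=
  hu.integrable_mul (memLp_exp_dual L).ofReal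

lemma integrable_berezin {u : (Fin n → ℂ) → ℂ} (hu : MemLp u 2 (gaussian n))
    (z : Fin n → ℂ) :
    Integrable (fun w => u w * normKernel w z * conj (normKernel w z)) (gaussian n) := by
  obtain ⟨L, hL⟩ := exists_dual_eq_herm z
  refine ((integrable_mul_exp_dual hu L).mul_const (Complex.exp (-herm z z))).congr
    (Filter.Eventually.of_forall fun w => ?_)
  simp only
  rw [mul_assoc (u w), mul_assoc (u w), normKernel_mul_conj, hL, Complex.ofReal_exp]

/-- The Berezin transform is injective on `L²(ℂⁿ, dμ)`. -/
lemma ae_eq_zero_of_berezin_eq_zero {u : (Fin n → ℂ) → ℂ} (hu : MemLp u 2 (gaussian n))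
    (h : ∀ z, berezin u z = 0) : u =ᵐ[gaussian n] 0 := by
  have hexp : ∀ L : StrongDual ℝ (Fin n → ℂ),
      ∫ w, u w * (Real.exp (L w) : ℂ) ∂(gaussian n) = 0 := by
    intro L
    obtain ⟨z, hz⟩ := exists_herm_eq_dual L
    have hb := h z
    simp only [berezin, mul_assoc (u _), normKernel_mul_conj, hz] at hb
    simp only [← mul_assoc (u _)] at hb
    rw [integral_mul_const] at hb
    simpa using (mul_eq_zero.1 hb).resolve_right (Complex.exp_ne_zero _)
  have hre : (fun w => (u w).re) =ᵐ[gaussian n] 0 := by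
    refine ae_eq_zero_of_integral_mul_exp_eq_zero hu.re fun L => ?_
    have := Complex.reCLM.integral_comp_comm (integrable_mul_exp_dual hu L)
    rw [hexp L] at this
    simpa only [Complex.reCLM_apply, Complex.re_mul_ofReal, map_zero] using this
  have him : (fun w => (u w).im) =ᵐ[gaussian n] 0 := by
    refine ae_eq_zero_of_integral_mul_exp_eq_zero hu.im fun L => ?_
    have := Complex.imCLM.integral_comp_comm (integrable_mul_exp_dual hu L)
    rw [hexp L] at this
    simpa only [Complex.imCLM_apply, Complex.im_mul_ofReal, map_zero] using this
  filter_upwards [hre, him] with w h1 h2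
  exact Complex.ext h1 h2

lemma ae_eq_of_berezin_eq {u v : (Fin n → ℂ) → ℂ} (hu : MemLp u 2 (gaussian n))
    (hv : MemLp v 2 (gaussian n)) (h : ∀ z, berezin u z = berezin v z) :
    u =ᵐ[gaussian n] v := by
  have h0 := ae_eq_zero_of_berezin_eq_zero (hu.sub hv) fun z => by
    rw [← sub_eq_zero.2 (h z), berezin, berezin, berezin,
      ← integral_sub (integrable_berezin hu z) (integrable_berezin hv z)]
    congr with w
    simp only [Pi.sub_apply]; ring
  filter_upwards [h0] with w hw
  exact sub_eq_zero.1 hw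

end Injectivity

end Fock

theorem mainTheorem2 (n N : ℕ) (f g : Fin N → (Fin n → ℂ) → ℂ)
    (hf : ∀ l, f l ∈ Fock.entireSym n) (hg : ∀ l, g l ∈ Fock.entireSym n) :
    -- the series defining `g_l*(ζ̄ - ∂_ζ) f_l(ζ)` converge (absolutely) at every point
    (∀ l ζ, Summable (Fock.opTerm (Fock.conjStar (g l)) (f l) ζ)) ∧
    -- every `L²` solution of `B[u] = ∑ f_l ḡ_l` is given by the formula
    (∀ u : (Fin n → ℂ) → ℂ, MemLp u 2 (Fock.gaussian n) →
      (∀ z, Fock.berezin u z = ∑ l, f l z * conj (g l z)) →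
      u =ᵐ[Fock.gaussian n] fun ζ => ∑ l, Fock.opApply (Fock.conjStar (g l)) (f l) ζ) ∧
    -- conversely, the formula gives an `L²` solution
    MemLp (fun ζ => ∑ l, Fock.opApply (Fock.conjStar (g l)) (f l) ζ) 2 (Fock.gaussian n) ∧
    ∀ z, Fock.berezin (fun ζ => ∑ l, Fock.opApply (Fock.conjStar (g l)) (f l) ζ) z =
      ∑ l, f l z * conj (g l z) := by
  choose Cf hf using fun l => Fock.exists_entireGrowth (hf l)
  choose Cg hg using fun l => Fock.exists_entireGrowth (hg l)
  have hop : (fun ζ => ∑ l, Fock.opApply (Fock.conjStar (g l)) (f l) ζ)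
      = fun ζ => ∑ l, Fock.invBerezin (f l) (g l) ζ := by
    funext ζ
    exact Finset.sum_congr rfl fun l _ => ((hf l).hasSum_opTerm (hg l) ζ).tsum_eq
  have hmem : MemLp (fun ζ => ∑ l, Fock.invBerezin (f l) (g l) ζ) 2 (Fock.gaussian n) :=
    memLp_finsetSum _ fun l _ => (hf l).memLp_invBerezin (hg l)
  have hber : ∀ z, Fock.berezin (fun ζ => ∑ l, Fock.invBerezin (f l) (g l) ζ) z =
      ∑ l, f l z * conj (g l z) := by
    intro z
    rw [Fock.berezin_eq_integral_translate,
      integral_finsetSum _ fun l _ => (hf l).integrable_translate_invBerezin (hg l) z]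
    refine Finset.sum_congr rfl fun l _ => ?_
    rw [← Fock.berezin_eq_integral_translate, (hf l).berezin_invBerezin (hg l)]
  rw [hop]
  exact ⟨fun l ζ => ((hf l).hasSum_opTerm (hg l) ζ).summable,
    fun u hu hB => Fock.ae_eq_of_berezin_eq hu hmem fun z => by rw [hB, hber], hmem, hber⟩
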